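/- **Triangular Peg Problem.** Let $d : S^1\times S^1\to\mathbb R$ be a continuous function with $d(x,y)=d(y,x)$ for all $x,y\in S^1$. Then there are three points $x,y,z\in S^1$, not all of them equal, such that $d(x,y)=d(y,z)=d(z,x)$. Moreover, for a space $X$ let $\Delta_{X^3}=\{(x,x,x) : x\in X\}$, and let the symmetric group $S_3$ act on $X^3\setminus\Delta_{X^3}$ by permuting the coordinates. Then there is no continuous $S_3$-equivariant map $(S^1)^3\setminus\Delta_{(S^1)^3}\to\mathbb R^3\setminus\Delta_{\mathbb R^3}$. -/

import Mathlib

/-- The thin diagonal `{(x, …, x)}` of `X ^ n`. -/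
def thinDiagonal (X : Type*) (n : ℕ) : Set (Fin n → X) :=
  {v | ∃ x : X, v = fun _ => x}

/-- The complement `X ^ n ∖ Δ` of the thin diagonal, with the subspace topology. -/
abbrev OffDiagonal (X : Type*) (n : ℕ) : Type _ :=
  {v : Fin n → X // v ∉ thinDiagonal X n}

/-- Permuting the coordinates of a point off the diagonal gives a point off the diagonal. -/
theorem comp_perm_notMem_thinDiagonal {X : Type*} {n : ℕ} {v : Fin n → X}
    (hv : v ∉ thinDiagonal X n) (σ : Equiv.Perm (Fin n)) :
    (fun i => v (σ⁻¹ i)) ∉ thinDiagonal X n := by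
  rintro ⟨x, hx⟩
  refine hv ⟨x, funext fun i => ?_⟩
  simpa using congrFun hx (σ i)

/-- The symmetric group on `n` letters acts on `X ^ n ∖ Δ` by permuting the coordinates,
`(σ • v) i = v (σ⁻¹ i)`. -/
instance (X : Type*) (n : ℕ) : MulAction (Equiv.Perm (Fin n)) (OffDiagonal X n) where
  smul σ v := ⟨fun i => v.1 (σ⁻¹ i), comp_perm_notMem_thinDiagonal v.2 σ⟩
  one_smul _ := rfl
  mul_smul σ τ v := Subtype.ext (funext fun i => by
    change v.1 ((σ * τ)⁻¹ i) = v.1 (τ⁻¹ (σ⁻¹ i))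
    rw [mul_inv_rev, Equiv.Perm.mul_apply])

/-!
A function `d` without an equilateral triple would give an `S₃`-equivariant map
`(x, y, z) ↦ (d (y, z), d (z, x), d (x, y))` off the diagonals, so it suffices to exclude such maps.

Identify `ℝ³` modulo its diagonal with `ℂ` by `y ↦ y₀ + ω y₁ + ω² y₂`, where `ω = exp (2πi / 3)`; the
complement of the diagonal goes to `ℂ ∖ {0}`. An equivariant map `f` assigns a winding number to
each loop `t ↦ (e^{it}, e^{i(t + θ)}, e^{i(t - θ)})`, `0 < θ < 2π`, and by homotopy invariance it does
not depend on `θ`.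
* For `θ = 2π / 3`, advancing `t` by a third of the period permutes the coordinates cyclically, hence
  multiplies the value in `ℂ` by `ω⁻¹`. The winding number is therefore not divisible by `3`.
* For `θ = π`, the second and third coordinates agree, hence so do those of the image, whose value
  in `ℂ` is then real. The winding number is therefore `0`.

`rotation_factor_eq_one` is the topological part, stated with a lift of the homotopy
through the covering map `exp : ℂ → ℂ ∖ {0}`.
-/

/-! ### Winding numbers of homotopies of loops -/

theorem exists_continuous_exp_eq {X : Type*} [TopologicalSpace X] [SimplyConnectedSpace X]
    [LocallyPathConnectedSpace X] {g : X → ℂ} (hg : Continuous g) (h0 : ∀ x, g x ≠ 0) :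
    ∃ l : X → ℂ, Continuous l ∧ ∀ x, Complex.exp (l x) = g x := by
  obtain ⟨x₀⟩ : Nonempty X := inferInstance
  let g' : C(X, {z : ℂ // z ≠ 0}) := ⟨fun x => ⟨g x, h0 x⟩, hg.subtype_mk h0⟩
  obtain ⟨l, ⟨-, hl⟩, -⟩ := Complex.isCoveringMap_exp.existsUnique_continuousMap_lifts g'
    (a₀ := x₀) (e₀ := Complex.log (g x₀)) (Subtype.ext (Complex.exp_log (h0 x₀)))
  exact ⟨l, l.continuous, fun x => congrArg Subtype.val (congrFun hl x)⟩

theorem eq_of_exp_eq_const {X : Type*} [TopologicalSpace X] [PreconnectedSpace X] {l : X → ℂ}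
    (hl : Continuous l) {c : ℂ} (hc : ∀ x, Complex.exp (l x) = c) (x y : X) : l x = l y :=
  Complex.isCoveringMap_exp.const_of_comp hl
    (fun a a' => Subtype.ext ((hc a).trans (hc a').symm)) x y

/-- A homotopy of loops in `ℂ ∖ {0}` through loops of period `n * p`: if one loop is multiplied by
`ζ` whenever its parameter advances by `p`, and another one is real, then `ζ = 1`. Indeed the real
loop has winding number `0`, whereas a logarithm of the first one increases by `n` times a
logarithm of `ζ` over a period. -/
theorem rotation_factor_eq_one {g : ℝ × ℝ → ℂ} (hg : Continuous g) (h0 : ∀ x, g x ≠ 0)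
    {n : ℕ} (hn : n ≠ 0) {p : ℝ} {ζ : ℂ} {a b : ℝ} (hper : ∀ s t, g (s, t + n * p) = g (s, t))
    (hrot : ∀ t, g (a, t + p) = ζ * g (a, t)) (hreal : ∀ t, (g (b, t)).im = 0) : ζ = 1 := by
  obtain ⟨l, hl, hexp⟩ := exists_continuous_exp_eq hg h0
  have hD : ∀ x y : ℝ × ℝ, l (x.1, x.2 + n * p) - l x = l (y.1, y.2 + n * p) - l y :=
    eq_of_exp_eq_const (c := 1) (by fun_prop) fun x => by
      rw [Complex.exp_sub, hexp, hexp, hper, div_self (h0 x)]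
  have hm_exp : ∀ t, Complex.exp (l (a, t + p) - l (a, t)) = ζ := fun t => by
    rw [Complex.exp_sub, hexp, hexp, hrot, mul_div_cancel_right₀ _ (h0 _)]
  have hm : ∀ t t' : ℝ, l (a, t + p) - l (a, t) = l (a, t' + p) - l (a, t') :=
    eq_of_exp_eq_const (by fun_prop) hm_exp
  have hsum : ∀ k : ℕ, l (a, 0 + k * p) - l (a, 0) = k * (l (a, 0 + p) - l (a, 0)) := by
    intro k
    induction k with
    | zero => simp
    | succ k ih =>
      have h := hm (0 + k * p) 0
      rw [show (0 : ℝ) + k * p + p = 0 + (k + 1 : ℕ) * p by push_cast; ring] at h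
      push_cast at h ih ⊢
      linear_combination h + ih
  -- On the real loop `exp (l - conj l) = 1`, so that the imaginary part of `l` is constant there.
  have hconj : ∀ t t' : ℝ, l (b, t) - (starRingEnd ℂ) (l (b, t)) =
      l (b, t') - (starRingEnd ℂ) (l (b, t')) :=
    eq_of_exp_eq_const (c := 1)
      ((hl.comp (by fun_prop)).sub (Complex.continuous_conj.comp (hl.comp (by fun_prop)))) fun t => by
      rw [Complex.exp_sub, Complex.exp_conj, hexp, Complex.conj_eq_iff_im.2 (hreal t),
        div_self (h0 _)]
  have him : (l (b, 0 + n * p) - l (b, 0)).im = 0 := by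
    have h := congrArg Complex.im (hconj (0 + n * p) 0)
    simp only [Complex.sub_im, Complex.conj_im] at h ⊢
    linarith
  have hD1 : Complex.exp (l (b, 0 + n * p) - l (b, 0)) = 1 := by
    rw [Complex.exp_sub, hexp, hexp, hper, div_self (h0 _)]
  have hD0 : l (b, 0 + n * p) - l (b, 0) = 0 := by
    obtain ⟨k, hk⟩ := Complex.exp_eq_one_iff.1 hD1
    rw [hk] at him ⊢
    have : (k : ℝ) = 0 := by simpa [Real.pi_ne_zero] using him
    simp [Int.cast_eq_zero.1 this]
  have hm0 : (n : ℂ) * (l (a, 0 + p) - l (a, 0)) = 0 := by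
    rw [← hsum, hD (a, 0) (b, 0), hD0]
  rw [← hm_exp 0, (mul_eq_zero.1 hm0).resolve_left (Nat.cast_ne_zero.2 hn), Complex.exp_zero]

/-! ### The quotient of `ℝ³` by its diagonal -/

/-- The primitive cube root of unity `exp (2πi / 3)`. -/
noncomputable def cubeRoot : ℂ := Complex.exp (2 * Real.pi * Complex.I / 3)

theorem cubeRoot_isPrimitiveRoot : IsPrimitiveRoot cubeRoot 3 :=
  Complex.isPrimitiveRoot_exp 3 (by norm_num)

theorem one_add_cubeRoot_add_sq : 1 + cubeRoot + cubeRoot ^ 2 = 0 := by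
  simpa [Finset.sum_range_succ] using cubeRoot_isPrimitiveRoot.geom_sum_eq_zero (by norm_num)

theorem cubeRoot_im_ne_zero : cubeRoot.im ≠ 0 := by
  intro h
  -- A real root of `1 + x + x²` is impossible.
  have hre := congrArg Complex.re one_add_cubeRoot_add_sq
  simp only [pow_two, Complex.add_re, Complex.mul_re, Complex.one_re, Complex.zero_re, h] at hre
  nlinarith [sq_nonneg (cubeRoot.re + 1 / 2)]

/-- The linear map `y ↦ y₀ + ω y₁ + ω² y₂` from `ℝ³` to `ℂ`, whose kernel is the diagonal. -/
noncomputable def discreteFourier (y : Fin 3 → ℝ) : ℂ :=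
  y 0 + cubeRoot * y 1 + cubeRoot ^ 2 * y 2

theorem continuous_discreteFourier : Continuous discreteFourier := by
  unfold discreteFourier
  fun_prop

theorem discreteFourier_ne_zero {y : Fin 3 → ℝ} (hy : y ∉ thinDiagonal ℝ 3) :
    discreteFourier y ≠ 0 := by
  intro h
  have h' : ((y 0 - y 2 : ℝ) : ℂ) + cubeRoot * ((y 1 - y 2 : ℝ) : ℂ) = 0 := by
    unfold discreteFourier at h
    push_cast
    linear_combination h - y 2 * one_add_cubeRoot_add_sq
  have him : y 1 - y 2 = 0 := by
    have := congrArg Complex.im h'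
    simpa [-Complex.ofReal_sub, cubeRoot_im_ne_zero] using this
  have hre : y 0 - y 2 = 0 := by
    have := congrArg Complex.re h'
    simpa [-Complex.ofReal_sub, him] using this
  refine hy ⟨y 2, funext fun i => ?_⟩
  fin_cases i
  · exact sub_eq_zero.1 hre
  · exact sub_eq_zero.1 him
  · rfl

theorem discreteFourier_rotate (y : Fin 3 → ℝ) :
    discreteFourier (fun i => y (finRotate 3 i)) = cubeRoot ^ 2 * discreteFourier y := by
  have h3 : cubeRoot ^ 3 = 1 := cubeRoot_isPrimitiveRoot.pow_eq_one
  simp only [discreteFourier, show finRotate 3 0 = 1 from rfl, show finRotate 3 1 = 2 from rfl,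
    show finRotate 3 2 = 0 from rfl]
  linear_combination (-(y 1 : ℂ) - cubeRoot * y 2) * h3

theorem discreteFourier_im_eq_zero {y : Fin 3 → ℝ} (h : y 1 = y 2) :
    (discreteFourier y).im = 0 := by
  have : discreteFourier y = ((y 0 - y 2 : ℝ) : ℂ) := by
    unfold discreteFourier
    rw [h]
    push_cast
    linear_combination y 2 * one_add_cubeRoot_add_sq
  rw [this, Complex.ofReal_im]

/-! ### Isosceles triples on the circle -/

/-- The triple `(e^{it}, e^{i(t + θ)}, e^{i(t - θ)})`. -/
noncomputable def isoscelesTriple (θ t : ℝ) : Fin 3 → Circle :=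
  ![Circle.exp t, Circle.exp (t + θ), Circle.exp (t - θ)]

theorem isoscelesTriple_notMem_thinDiagonal {θ : ℝ} (h0 : 0 < θ) (h1 : θ < 2 * Real.pi) (t : ℝ) :
    isoscelesTriple θ t ∉ thinDiagonal Circle 3 := by
  rintro ⟨x, hx⟩
  have h : Circle.exp (t + θ) = Circle.exp t := (congrFun hx 1).trans (congrFun hx 0).symm
  obtain ⟨m, hm⟩ := Circle.exp_eq_exp.1 h
  have hθ : θ = m * (2 * Real.pi) := by linarith
  have hm0 : (0 : ℝ) < m := pos_of_mul_pos_left (hθ ▸ h0) Real.two_pi_pos.le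
  have hm1 : (m : ℝ) < 1 := by
    by_contra! hle
    nlinarith [Real.two_pi_pos]
  norm_cast at hm0 hm1
  omega

theorem isoscelesTriple_add_two_pi (θ t : ℝ) :
    isoscelesTriple θ (t + 2 * Real.pi) = isoscelesTriple θ t := by
  simp only [isoscelesTriple, Circle.exp_add, Circle.exp_sub, Circle.exp_two_pi, mul_one]

theorem isoscelesTriple_rotate (t : ℝ) :
    isoscelesTriple (2 * Real.pi / 3) (t + 2 * Real.pi / 3) =
      fun i => isoscelesTriple (2 * Real.pi / 3) t (finRotate 3 i) := by
  funext i
  fin_cases i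
  · rfl
  · exact Circle.exp_eq_exp.2 ⟨1, by push_cast; ring⟩
  · exact congrArg Circle.exp (by ring)

theorem isoscelesTriple_pi_swap (t : ℝ) :
    isoscelesTriple Real.pi t = fun i => isoscelesTriple Real.pi t (Equiv.swap 1 2 i) := by
  funext i
  fin_cases i
  · rfl
  · exact Circle.exp_eq_exp.2 ⟨1, by push_cast; ring⟩
  · exact Circle.exp_eq_exp.2 ⟨-1, by push_cast; ring⟩

/-! ### Equivariant maps -/

theorem OffDiagonal.smul_val {X : Type*} {n : ℕ} (σ : Equiv.Perm (Fin n)) (v : OffDiagonal X n) :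
    (σ • v).1 = fun i => v.1 (σ⁻¹ i) := rfl

theorem not_exists_continuous_equivariant :
    ¬ ∃ f : OffDiagonal Circle 3 →[Equiv.Perm (Fin 3)] OffDiagonal ℝ 3, Continuous f := by
  rintro ⟨f, hf⟩
  -- The angle stays in `[2π / 3, 4π / 3]`, and it is equal to `2π / 3` at `s = 0` and to `π` at `s = π / 2`.
  let θ : ℝ → ℝ := fun s => Real.pi - Real.pi / 3 * Real.cos s
  have hθ0 : θ 0 = 2 * Real.pi / 3 := by simp only [θ, Real.cos_zero]; ring
  have hθ1 : θ (Real.pi / 2) = Real.pi := by simp [θ]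
  have hpos : ∀ s, 0 < θ s := fun s => by
    change 0 < Real.pi - Real.pi / 3 * Real.cos s
    nlinarith [Real.pi_pos, Real.cos_le_one s]
  have hlt : ∀ s, θ s < 2 * Real.pi := fun s => by
    change Real.pi - Real.pi / 3 * Real.cos s < 2 * Real.pi
    nlinarith [Real.pi_pos, Real.neg_one_le_cos s]
  let v : ℝ × ℝ → OffDiagonal Circle 3 := fun x =>
    ⟨isoscelesTriple (θ x.1) x.2, isoscelesTriple_notMem_thinDiagonal (hpos _) (hlt _) _⟩
  have hv : Continuous v := by
    refine Continuous.subtype_mk (continuous_pi fun i => ?_) _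
    fin_cases i
    · exact Circle.exp.continuous.comp continuous_snd
    · exact Circle.exp.continuous.comp (by fun_prop : Continuous fun x : ℝ × ℝ => x.2 + θ x.1)
    · exact Circle.exp.continuous.comp (by fun_prop : Continuous fun x : ℝ × ℝ => x.2 - θ x.1)
  have hone : cubeRoot ^ 2 = 1 := by
    refine rotation_factor_eq_one (g := fun x => discreteFourier (f (v x)).1) (n := 3)
      (p := 2 * Real.pi / 3) (a := 0) (b := Real.pi / 2)
      (continuous_discreteFourier.comp (continuous_subtype_val.comp (hf.comp hv)))
      (fun x => discreteFourier_ne_zero (f (v x)).2) (by norm_num) (fun s t => ?_) (fun t => ?_)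
      fun t => ?_
    · have h : v (s, t + (3 : ℕ) * (2 * Real.pi / 3)) = v (s, t) := Subtype.ext (by
        change isoscelesTriple (θ s) _ = isoscelesTriple (θ s) t
        rw [← isoscelesTriple_add_two_pi (θ s) t]
        congr 1
        push_cast
        ring)
      simp only [h]
    · have h : v (0, t + 2 * Real.pi / 3) = (finRotate 3)⁻¹ • v (0, t) := Subtype.ext (by
        rw [OffDiagonal.smul_val, inv_inv]
        change isoscelesTriple (θ 0) _ = fun i => isoscelesTriple (θ 0) t _
        rw [hθ0, isoscelesTriple_rotate]
        rfl)
      simp only [h, map_smul, OffDiagonal.smul_val, inv_inv, discreteFourier_rotate]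
    · have h : v (Real.pi / 2, t) =
          Equiv.swap (1 : Fin 3) 2 • v (Real.pi / 2, t) := Subtype.ext (by
        rw [OffDiagonal.smul_val, Equiv.swap_inv]
        change isoscelesTriple (θ (Real.pi / 2)) t = fun i => isoscelesTriple (θ (Real.pi / 2)) t _
        rw [hθ1]
        exact isoscelesTriple_pi_swap t)
      refine discreteFourier_im_eq_zero ?_
      have h' := congrArg f h
      rw [map_smul] at h'
      exact congrFun (congrArg Subtype.val h') 1
  exact cubeRoot_isPrimitiveRoot.pow_ne_one_of_pos_of_lt (by norm_num) (by norm_num) hone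

/-- The side lengths of a triple, the `i`-th one being opposite to the `i`-th vertex. -/
def oppositeSides {X : Type*} (d : X × X → ℝ) (v : Fin 3 → X) : Fin 3 → ℝ :=
  ![d (v 1, v 2), d (v 2, v 0), d (v 0, v 1)]

theorem oppositeSides_perm {X : Type*} {d : X × X → ℝ} (hd : ∀ x y, d (x, y) = d (y, x))
    (v : Fin 3 → X) (σ : Equiv.Perm (Fin 3)) :
    oppositeSides d (fun i => v (σ i)) = fun i => oppositeSides d v (σ i) := by
  -- The side opposite to `i` joins the other two vertices, in whichever order.
  have key : ∀ i j k : Fin 3, i ≠ j → j ≠ k → k ≠ i → oppositeSides d v i = d (v j, v k) := by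
    intro i j k hij hjk hki
    fin_cases i <;> fin_cases j <;> fin_cases k <;> first
      | exact absurd rfl hij
      | exact absurd rfl hjk
      | exact absurd rfl hki
      | rfl
      | exact hd _ _
  have hσ : ∀ {i j : Fin 3}, i ≠ j → σ i ≠ σ j := fun h => σ.injective.ne h
  funext i
  fin_cases i
  · exact (key _ _ _ (hσ (by decide)) (hσ (by decide)) (hσ (by decide))).symm
  · exact (key _ _ _ (hσ (by decide)) (hσ (by decide)) (hσ (by decide))).symm
  · exact (key _ _ _ (hσ (by decide)) (hσ (by decide)) (hσ (by decide))).symm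

theorem mainTheorem4 :
    (∀ d : Circle × Circle → ℝ, Continuous d → (∀ x y : Circle, d (x, y) = d (y, x)) →
      ∃ x y z : Circle, ¬ (x = y ∧ y = z) ∧ d (x, y) = d (y, z) ∧ d (y, z) = d (z, x)) ∧
    ¬ ∃ f : OffDiagonal Circle 3 →[Equiv.Perm (Fin 3)] OffDiagonal ℝ 3, Continuous f := by
  refine ⟨fun d hd hsymm => ?_, not_exists_continuous_equivariant⟩
  by_contra! hne
  have hoff : ∀ v : OffDiagonal Circle 3, oppositeSides d v.1 ∉ thinDiagonal ℝ 3 := by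
    rintro ⟨v, hv⟩ ⟨c, hc⟩
    have h0 : d (v 1, v 2) = c := congrFun hc 0
    have h1 : d (v 2, v 0) = c := congrFun hc 1
    have h2 : d (v 0, v 1) = c := congrFun hc 2
    refine hne (v 0) (v 1) (v 2) (fun h01 h12 => hv ⟨v 0, funext fun i => ?_⟩)
      (h2.trans h0.symm) (h0.trans h1.symm)
    fin_cases i
    · rfl
    · exact h01.symm
    · exact (h01.trans h12).symm
  refine not_exists_continuous_equivariant
    ⟨⟨fun v => ⟨oppositeSides d v.1, hoff v⟩, fun σ v =>
      Subtype.ext (oppositeSides_perm hsymm v.1 σ⁻¹)⟩,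
      Continuous.subtype_mk (continuous_pi fun i => ?_) _⟩
  have hcoord : ∀ j, Continuous fun v : OffDiagonal Circle 3 => v.1 j := fun j =>
    (continuous_apply j).comp continuous_subtype_val
  fin_cases i
  · exact hd.comp ((hcoord 1).prodMk (hcoord 2))
  · exact hd.comp ((hcoord 2).prodMk (hcoord 0))
  · exact hd.comp ((hcoord 0).prodMk (hcoord 1))
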